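/- Let $(a_n)_{n\ge 0}$ be a sequence of positive real numbers with $a_0=1$ for which there is an $\epsilon>0$ with $$a_n^2-\tfrac12 a_{n+1}^2\ \ge\ \epsilon\, a_n^2\qquad\text{for all } n\ge 0,$$ and put $b_n=(2^{-n}a_n)^2$, so that $b_0=1$ and $b_n-2b_{n+1}\ge\epsilon b_n$ for all $n\ge 0$. Let $\mathfrak C_0=\{[1,2]\}$ and, recursively, let $\mathfrak C_{n+1}$ consist of the intervals $[s,s+b_{n+1}]$ and $[t-b_{n+1},t]$ for all $[s,t]\in\mathfrak C_n$. Let $C_{b_n}$ be the union of the intervals in $\mathfrak C_n$, and let $C_b=\bigcap_{n\ge1}C_{b_n}\subset[1,2]$ be the generalized Cantor set. Let $f_{b_0}(x)=x-1$ on $[1,2]$, extended by $0$ to the left of $1$ and by $1$ to the right of $2$. Recursively, $f_{b_{n+1}}$ agrees with $f_{b_n}$ off $C_{b_n}$, and for each $J=[s,t]\in\mathfrak C_n$ it agrees with $f_{b_n}$ at $s$ and $t$, equals $\tfrac12(f_{b_n}(s)+f_{b_n}(t))$ on $J\setminus C_{b_{n+1}}$, and, on each of the two intervals of $\mathfrak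 C_{n+1}$ contained in $J$, interpolates linearly and continuously. Let $f_b=\lim_{n\to\infty}f_{b_n}$ be the generalized Cantor function. Let $B=(B(t))_{t\ge0}$ be a standard one-dimensional Brownian motion with $B(0)=0$. If $$\sum_{n=1}^\infty a_n<\infty\qquad\text{or}\qquad\sum_{n=1}^\infty\frac1{a_n}<\infty ,$$ then $$\mathbb P\bigl(\text{there is a } t\in C_b \text{ with } B(t)=f_b(t)\bigr)>0 ;$$ in particular this set is an event, that is, it is measurable up to a null set. -/

import Mathlib

open MeasureTheory ProbabilityTheory Set Filter Topology
open scoped NNReal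

namespace GenCantor

noncomputable section

/-- The interval lengths `b_n = (2^{-n} a_n)^2`. -/
def lengths (a : ℕ → ℝ) (n : ℕ) : ℝ := ((2 : ℝ) ^ (-(n : ℤ)) * a n) ^ 2

/-- The family of level-`n` intervals, an interval `[s, t]` being recorded as the pair `(s, t)`.
Level `0` consists of `[1, 2]`; each `[s, t]` of level `n` yields its left and its right closed
subinterval of length `b (n + 1)`. -/
def intervals (b : ℕ → ℝ) : ℕ → Set (ℝ × ℝ)
  | 0 => {(1, 2)}
  | n + 1 => ⋃ J ∈ intervals b n, {(J.1, J.1 + b (n + 1)), (J.2 - b (n + 1), J.2)}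

/-- The union of the level-`n` intervals. -/
def level (b : ℕ → ℝ) (n : ℕ) : Set ℝ := ⋃ J ∈ intervals b n, Icc J.1 J.2

/-- The generalized Cantor set, the intersection of the levels `n ≥ 1`. -/
def cantorSet (b : ℕ → ℝ) : Set ℝ := ⋂ n ≥ 1, level b n

/-- The function on `J = [s, t]` with values `y` at `s` and `z` at `t`, equal to `(y + z) / 2` off
the two end intervals `[s, s + β]` and `[t - β, t]`, and linear on each of these two. -/
def refine (J : ℝ × ℝ) (y z β x : ℝ) : ℝ :=
  if x ≤ J.1 + β then y + (z - y) / 2 * ((x - J.1) / β)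
  else if J.2 - β ≤ x then z - (z - y) / 2 * ((J.2 - x) / β)
  else (y + z) / 2

open Classical in
/-- The approximations of the generalized Cantor function. Stage `0` is linear on `[1, 2]`
from `0` to `1` (and is extended by `0` to the left and by `1` to the right). Stage `n + 1` modifies
stage `n` exactly on the level-`n` intervals `J = [s, t]`, keeping the values at `s` and `t`.
(The level-`n` intervals are pairwise disjoint when `b n > 2 * b (n + 1)` for all `n`, with `b 0 = 1`,
so the interval `J` that contains `x` is then unique.) -/
def approx (b : ℕ → ℝ) : ℕ → ℝ → ℝ
  | 0, x => max 0 (min 1 (x - 1))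
  | n + 1, x =>
      if h : ∃ J ∈ intervals b n, x ∈ Icc J.1 J.2 then
        refine h.choose (approx b n h.choose.1) (approx b n h.choose.2) (b (n + 1)) x
      else approx b n x

/-- The generalized Cantor function, the pointwise limit of its approximations. -/
def cantorFun (b : ℕ → ℝ) (x : ℝ) : ℝ := limUnder atTop (fun n => approx b n x)

/-- The set of zeros of `g` in `(0, ∞)`. -/
def zeros (g : ℝ → ℝ) : Set ℝ := {t | 0 < t ∧ g t = 0}

/-- The event that `B - f_b` has a zero in `C_b`. -/
def hitEvent {Ω : Type*} (B : ℝ≥0 → Ω → ℝ) (b : ℕ → ℝ) : Set Ω :=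
  {ω | (zeros (fun t => B t.toNNReal ω - cantorFun b t) ∩ cantorSet b).Nonempty}

end

end GenCantor

/-! The proof is a second moment argument over the left endpoints of the level-`m` intervals. At the
`i`-th one `f_b` equals `i / 2 ^ m`. Put `h = 2 ^ (-m)` and let `nearEvent` say that `B` is within
`h / 4` of this value. The endpoints lie in `[1, 2]`, so each of these `2 ^ m` events has
probability of order `h`, and the first moments add up to at least a constant. Two endpoints that
first separate below a common level-`n` interval lie at a distance `τ` between `ε * b n` and `b n`.
By independence of increments, the corresponding events occur together with probability at most
about `h ^ 2 * τ ^ (-1/2) * exp (-(k * h) ^ 2 / (8 * τ))`, where `k` is the difference of indices.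
There are two ways to sum this over the pairs separating at level `n`. The Gaussian factor leaves
effectively `b n / h ^ 2` pairs in each of the `2 ^ n` intervals, for a total of order `2 ^ n * √(b
n) = a n`. Dropping that factor and counting all pairs gives order `1 / a n` instead. Under either
summability assumption the second moments are thus bounded uniformly in `m`
(`exists_interaction_sum_le`), and `le_measureReal_biUnion` bounds the probability that some near
event occurs from below, uniformly in `m`. To pass to the limit: `C_b` is compact, `f_b` is
continuous on it and the left endpoints are dense in it, so on continuous paths a zero exists
exactly when `|B - f_b|` is arbitrarily small on this countable set. The hitting event is therefore
almost surely a decreasing intersection of null-measurable events (`hitEvent_ae_eq`), and continuity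
from above preserves the lower bound. -/

namespace GenCantor

/-! ### Binary indexing of the intervals and topology of the Cantor set -/

/-- The offset from `1` of the left endpoint of the `i`-th interval of level `n`. -/
noncomputable def leftOffset (b : ℕ → ℝ) : ℕ → ℕ → ℝ
  | 0, _ => 0
  | n + 1, i => leftOffset b n (i / 2) + ((i % 2 : ℕ) : ℝ) * (b n - b (n + 1))

/-- The `i`-th interval of level `n`. -/
def piece (b : ℕ → ℝ) (n i : ℕ) : Set ℝ :=
  Icc (1 + leftOffset b n i) (1 + leftOffset b n i + b n)

theorem leftOffset_two_mul (b : ℕ → ℝ) (n i : ℕ) :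
    leftOffset b (n + 1) (2 * i) = leftOffset b n i := by
  simp [leftOffset]

theorem leftOffset_two_mul_add_one (b : ℕ → ℝ) (n i : ℕ) :
    leftOffset b (n + 1) (2 * i + 1) = leftOffset b n i + (b n - b (n + 1)) := by
  have h1 : (2 * i + 1) / 2 = i := by omega
  have h2 : (2 * i + 1) % 2 = 1 := by omega
  simp [leftOffset, h1, h2]

theorem leftOffset_mul_two_pow (b : ℕ → ℝ) (n i d : ℕ) :
    leftOffset b (n + d) (i * 2 ^ d) = leftOffset b n i := by
  induction d with
  | zero => simp
  | succ d ih =>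
    rw [← ih, ← leftOffset_two_mul b (n + d), pow_succ,
      show i * (2 ^ d * 2) = 2 * (i * 2 ^ d) by ring, add_assoc]

theorem intervals_eq {b : ℕ → ℝ} (h0 : b 0 = 1) (n : ℕ) :
    intervals b n =
      {J | ∃ i < 2 ^ n, J = (1 + leftOffset b n i, 1 + leftOffset b n i + b n)} := by
  induction n with
  | zero =>
    ext J
    simp only [intervals, leftOffset, h0, mem_singleton_iff, mem_ofPred_eq, pow_zero,
      Nat.lt_one_iff, exists_eq_left]
    norm_num
  | succ n ih =>
    ext J
    simp only [intervals, ih, mem_iUnion, mem_ofPred_eq, mem_insert_iff, mem_singleton_iff,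
      exists_prop]
    constructor
    · rintro ⟨J', ⟨i, hi, rfl⟩, rfl | rfl⟩
      · exact ⟨2 * i, by rw [pow_succ]; omega, by rw [leftOffset_two_mul]⟩
      · refine ⟨2 * i + 1, by rw [pow_succ]; omega, ?_⟩
        rw [leftOffset_two_mul_add_one]
        ext <;> simp <;> ring
    · rintro ⟨i, hi, rfl⟩
      refine ⟨_, ⟨i / 2, by rw [pow_succ] at hi; omega, rfl⟩, ?_⟩
      rcases Nat.even_or_odd' i with ⟨k, rfl | rfl⟩
      · left
        rw [leftOffset_two_mul]; simp
      · right
        have h1 : (2 * k + 1) / 2 = k := by omega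
        rw [leftOffset_two_mul_add_one, h1]
        ext <;> simp <;> ring

theorem level_eq {b : ℕ → ℝ} (h0 : b 0 = 1) (n : ℕ) :
    level b n = ⋃ i ∈ Iio (2 ^ n), piece b n i := by
  ext x
  simp only [level, intervals_eq h0, piece, mem_iUnion, mem_ofPred_eq, mem_Iio, exists_prop]
  constructor
  · rintro ⟨J, ⟨i, hi, rfl⟩, hx⟩
    exact ⟨i, hi, hx⟩
  · rintro ⟨i, hi, hx⟩
    exact ⟨_, ⟨i, hi, rfl⟩, hx⟩

section

variable {b : ℕ → ℝ}

theorem piece_subset (hpos : ∀ n, 0 < b n) (hgap : ∀ n, 2 * b (n + 1) < b n) (n i : ℕ) :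
    piece b (n + 1) i ⊆ piece b n (i / 2) := by
  have h1 := hpos (n + 1)
  have h2 := hgap n
  rcases Nat.even_or_odd' i with ⟨k, rfl | rfl⟩
  · rw [piece, leftOffset_two_mul, piece, Nat.mul_div_cancel_left _ two_pos]
    exact Icc_subset_Icc le_rfl (by linarith)
  · have h3 : (2 * k + 1) / 2 = k := by omega
    rw [piece, leftOffset_two_mul_add_one, piece, h3]
    exact Icc_subset_Icc (by linarith) (by linarith)

theorem leftOffset_add_lt (hpos : ∀ n, 0 < b n) (hgap : ∀ n, 2 * b (n + 1) < b n) {n i j : ℕ}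
    (hij : i < j) (hj : j < 2 ^ n) : leftOffset b n i + b n < leftOffset b n j := by
  induction n generalizing i j with
  | zero => simp at hj; omega
  | succ n ih =>
    have h1 := hpos (n + 1)
    have h2 := hgap n
    rw [pow_succ] at hj
    rcases Nat.even_or_odd' i with ⟨k, rfl | rfl⟩ <;>
    rcases Nat.even_or_odd' j with ⟨l, rfl | rfl⟩ <;>
    simp only [leftOffset_two_mul, leftOffset_two_mul_add_one]
    · have := @ih k l (by omega) (by omega); linarith
    · rcases (show k ≤ l by omega).eq_or_lt with rfl | hkl
      · linarith
      · have := @ih k l hkl (by omega); linarith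
    · have := @ih k l (by omega) (by omega); linarith
    · have := @ih k l (by omega) (by omega); linarith

theorem eq_of_mem_piece (hpos : ∀ n, 0 < b n) (hgap : ∀ n, 2 * b (n + 1) < b n) {n i j : ℕ}
    (hi : i < 2 ^ n) (hj : j < 2 ^ n) {x : ℝ} (hxi : x ∈ piece b n i) (hxj : x ∈ piece b n j) :
    i = j := by
  by_contra hne
  rcases lt_or_gt_of_ne hne with h | h
  · have := leftOffset_add_lt hpos hgap h hj
    linarith [hxi.2, hxj.1]
  · have := leftOffset_add_lt hpos hgap h hi
    linarith [hxj.2, hxi.1]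

theorem exists_mem_piece (h0 : b 0 = 1) (hpos : ∀ n, 0 < b n) (hgap : ∀ n, 2 * b (n + 1) < b n)
    {x : ℝ} (hx : x ∈ cantorSet b) (n : ℕ) : ∃ i < 2 ^ n, x ∈ piece b n i := by
  have key : ∀ m ≥ 1, ∃ i < 2 ^ m, x ∈ piece b m i := fun m hm => by
    have := mem_iInter₂.1 hx m hm
    rw [level_eq h0] at this
    simpa using this
  -- The intersection defining `cantorSet` starts at level 1, so level 0 is recovered from the
  -- parent of a level-1 interval.
  rcases Nat.eq_zero_or_pos n with rfl | hn
  · obtain ⟨i, hi, h⟩ := key 1 le_rfl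
    exact ⟨i / 2, by omega, piece_subset hpos hgap 0 i h⟩
  · exact key n hn

/-- At deeper levels the point stays a left endpoint, its index gaining zero binary digits; at
shallower levels nestedness applies. -/
theorem leftEnd_mem_cantorSet (h0 : b 0 = 1) (hpos : ∀ n, 0 < b n)
    (hgap : ∀ n, 2 * b (n + 1) < b n) {n i : ℕ} (hi : i < 2 ^ n) :
    1 + leftOffset b n i ∈ cantorSet b := by
  have key : ∀ m, ∃ j < 2 ^ m, 1 + leftOffset b n i ∈ piece b m j := fun m => by
    rcases le_total n m with h | h
    · obtain ⟨d, rfl⟩ := Nat.exists_eq_add_of_le h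
      refine ⟨i * 2 ^ d, by rw [pow_add]; gcongr, ?_⟩
      rw [piece, leftOffset_mul_two_pow]
      exact left_mem_Icc.2 (by linarith [hpos (n + d)])
    · induction h using Nat.decreasingInduction with
      | self => exact ⟨i, hi, left_mem_Icc.2 (by linarith [hpos n])⟩
      | of_succ m hm ih =>
        obtain ⟨j, hj, h⟩ := ih
        exact ⟨j / 2, by rw [pow_succ] at hj; omega, piece_subset hpos hgap m j h⟩
  refine mem_iInter₂.2 fun m _ => ?_
  rw [level_eq h0]
  simpa using key m

theorem isCompact_cantorSet (h0 : b 0 = 1) : IsCompact (cantorSet b) := by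
  have hc : ∀ n, IsCompact (level b n) := fun n => by
    rw [level_eq h0]
    exact (finite_Iio _).isCompact_biUnion fun i _ => isCompact_Icc
  refine (hc 1).of_isClosed_subset (isClosed_biInter fun n _ => (hc n).isClosed) ?_
  exact biInter_subset_of_mem (show (1 : ℕ) ≥ 1 from le_rfl)

/-! ### Values and continuity of the Cantor function on the Cantor set -/

theorem approx_succ_of_mem (h0 : b 0 = 1) (hpos : ∀ n, 0 < b n)
    (hgap : ∀ n, 2 * b (n + 1) < b n) {n i : ℕ} (hi : i < 2 ^ n) {x : ℝ}
    (hx : x ∈ piece b n i) :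
    approx b (n + 1) x =
      GenCantor.refine (1 + leftOffset b n i, 1 + leftOffset b n i + b n)
        (approx b n (1 + leftOffset b n i)) (approx b n (1 + leftOffset b n i + b n))
        (b (n + 1)) x := by
  have h : ∃ J ∈ intervals b n, x ∈ Icc J.1 J.2 := by
    rw [intervals_eq h0]
    exact ⟨_, ⟨i, hi, rfl⟩, hx⟩
  -- Disjointness of the level-`n` intervals removes the ambiguity of the choice.
  have hJ : h.choose = (1 + leftOffset b n i, 1 + leftOffset b n i + b n) := by
    obtain ⟨h1, h2⟩ := h.choose_spec
    have h3 := (Set.ext_iff.1 (intervals_eq h0 n) _).1 h1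
    obtain ⟨j, hj, hJj⟩ := h3
    have hxj : x ∈ piece b n j := by rw [hJj] at h2; exact h2
    rw [hJj, eq_of_mem_piece hpos hgap hi hj hx hxj]
  rw [approx, dif_pos h, hJ]

theorem refine_of_le {s t y z β x : ℝ} (hx : x ≤ s + β) :
    GenCantor.refine (s, t) y z β x = y + (z - y) / 2 * ((x - s) / β) := by
  simp [GenCantor.refine, hx]

theorem refine_of_ge {s t y z β x : ℝ} (h : s + β < t - β) (hx : t - β ≤ x) :
    GenCantor.refine (s, t) y z β x = z - (z - y) / 2 * ((t - x) / β) := by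
  have : ¬ x ≤ s + β := by linarith
  simp [GenCantor.refine, hx, this]

theorem approx_endpoints (h0 : b 0 = 1) (hpos : ∀ n, 0 < b n)
    (hgap : ∀ n, 2 * b (n + 1) < b n) {n i : ℕ} (hi : i < 2 ^ n) :
    approx b n (1 + leftOffset b n i) = i / 2 ^ n ∧
      approx b n (1 + leftOffset b n i + b n) = (i + 1) / 2 ^ n := by
  induction n generalizing i with
  | zero =>
    have : i = 0 := by simpa using hi
    subst this
    simp [approx, leftOffset, h0]
  | succ n ih =>
    have hβ := hpos (n + 1)
    have hg := hgap n
    have hi' : i / 2 < 2 ^ n := by rw [pow_succ] at hi; omega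
    obtain ⟨e1, e2⟩ := ih hi'
    have hl : 1 + leftOffset b (n + 1) i ∈ piece b n (i / 2) :=
      piece_subset hpos hgap n i (left_mem_Icc.2 (by linarith))
    have hr : 1 + leftOffset b (n + 1) i + b (n + 1) ∈ piece b n (i / 2) :=
      piece_subset hpos hgap n i (right_mem_Icc.2 (by linarith))
    rw [approx_succ_of_mem h0 hpos hgap hi' hl, approx_succ_of_mem h0 hpos hgap hi' hr, e1, e2]
    rcases Nat.even_or_odd' i with ⟨k, rfl | rfl⟩
    · rw [Nat.mul_div_cancel_left _ two_pos, leftOffset_two_mul, refine_of_le (by linarith),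
        refine_of_le (by linarith)]
      push_cast
      constructor <;> field_simp <;> ring
    · have h1 : (2 * k + 1) / 2 = k := by omega
      rw [h1, leftOffset_two_mul_add_one, refine_of_ge (by linarith) (by linarith),
        refine_of_ge (by linarith) (by linarith)]
      push_cast
      constructor <;> field_simp <;> ring

theorem approx_mem_Icc (h0 : b 0 = 1) (hpos : ∀ n, 0 < b n)
    (hgap : ∀ n, 2 * b (n + 1) < b n) {n i : ℕ} (hi : i < 2 ^ n) {x : ℝ}
    (hx : x ∈ piece b n i) :
    approx b n x ∈ Icc ((i : ℝ) / 2 ^ n) ((i + 1) / 2 ^ n) := by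
  cases n with
  | zero =>
    have : i = 0 := by simpa using hi
    subst this
    simp [approx]
  | succ n =>
    have hβ := hpos (n + 1)
    have hg := hgap n
    have hi' : i / 2 < 2 ^ n := by rw [pow_succ] at hi; omega
    obtain ⟨e1, e2⟩ := approx_endpoints h0 hpos hgap hi'
    rw [approx_succ_of_mem h0 hpos hgap hi' (piece_subset hpos hgap n i hx), e1, e2]
    obtain ⟨hx1, hx2⟩ := hx
    have h2 : (0 : ℝ) < 2 ^ n := by positivity
    rcases Nat.even_or_odd' i with ⟨k, rfl | rfl⟩
    · rw [leftOffset_two_mul] at hx1 hx2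
      rw [Nat.mul_div_cancel_left _ two_pos, refine_of_le (by linarith)]
      set r := (x - (1 + leftOffset b n k)) / b (n + 1) with hr
      have r0 : 0 ≤ r := div_nonneg (by linarith) hβ.le
      have r1 : r ≤ 1 := (div_le_one hβ).2 (by linarith)
      have e : (k : ℝ) / 2 ^ n + ((k + 1) / 2 ^ n - k / 2 ^ n) / 2 * r
          = (2 * k + r) / 2 ^ (n + 1) := by rw [pow_succ]; field_simp; ring
      rw [e]
      push_cast
      constructor <;> gcongr <;> linarith
    · have h1 : (2 * k + 1) / 2 = k := by omega
      rw [leftOffset_two_mul_add_one] at hx1 hx2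
      rw [h1, refine_of_ge (by linarith) (by linarith)]
      set r := (1 + leftOffset b n k + b n - x) / b (n + 1) with hr
      have r0 : 0 ≤ r := div_nonneg (by linarith) hβ.le
      have r1 : r ≤ 1 := (div_le_one hβ).2 (by linarith)
      have e : ((k : ℝ) + 1) / 2 ^ n - ((k + 1) / 2 ^ n - k / 2 ^ n) / 2 * r
          = (2 * k + 2 - r) / 2 ^ (n + 1) := by rw [pow_succ]; field_simp; ring
      rw [e]
      push_cast
      constructor <;> gcongr <;> linarith

theorem approx_mem_Icc_of_le (h0 : b 0 = 1) (hpos : ∀ n, 0 < b n)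
    (hgap : ∀ n, 2 * b (n + 1) < b n) {n i m : ℕ} (hi : i < 2 ^ n) (hnm : n ≤ m) {x : ℝ}
    (hx : x ∈ piece b n i) (hxC : x ∈ cantorSet b) :
    approx b m x ∈ Icc ((i : ℝ) / 2 ^ n) ((i + 1) / 2 ^ n) := by
  obtain ⟨j, hj, hxj⟩ := exists_mem_piece h0 hpos hgap hxC m
  refine Icc_subset_Icc ?_ ?_ (approx_mem_Icc h0 hpos hgap hj hxj) <;>
  · obtain ⟨d, rfl⟩ := Nat.exists_eq_add_of_le hnm
    -- The level-`n` ancestor of the `j`-th interval of level `n + d` has index `j / 2 ^ d`, so the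
    -- dyadic value intervals are nested in the same way.
    have hd : ∀ d j, x ∈ piece b (n + d) j → x ∈ piece b n (j / 2 ^ d) := by
      intro d
      induction d with
      | zero => intro j h; simpa using h
      | succ d ih =>
        intro j h
        have := ih _ (piece_subset hpos hgap _ _ h)
        rwa [Nat.div_div_eq_div_mul, ← pow_succ'] at this
    have hlt : j / 2 ^ d < 2 ^ n := Nat.div_lt_of_lt_mul (by rwa [mul_comm, ← pow_add])
    have hij := eq_of_mem_piece hpos hgap hi hlt hx (hd d j hxj)
    have h1 : i * 2 ^ d ≤ j := by rw [hij]; exact Nat.div_mul_le_self _ _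
    have h2 : j + 1 ≤ (i + 1) * 2 ^ d := by
      rw [hij, mul_comm]
      exact Nat.lt_mul_div_succ j (by positivity)
    have h1' : (i : ℝ) * 2 ^ d ≤ j := by exact_mod_cast h1
    have h2' : (j : ℝ) + 1 ≤ (i + 1) * 2 ^ d := by exact_mod_cast h2
    rw [div_le_div_iff₀ (by positivity) (by positivity), pow_add]
    have : (0 : ℝ) < 2 ^ n := by positivity
    nlinarith

/-- From stage `n` on, all values at `x` lie in one dyadic interval of length `2 ^ (-n)`.
Convergence is needed only on `C_b`, the only place where `hitEvent` looks. -/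
theorem tendsto_approx (h0 : b 0 = 1) (hpos : ∀ n, 0 < b n)
    (hgap : ∀ n, 2 * b (n + 1) < b n) {x : ℝ} (hx : x ∈ cantorSet b) :
    Tendsto (fun n => approx b n x) atTop (𝓝 (cantorFun b x)) := by
  refine CauchySeq.tendsto_limUnder (Metric.cauchySeq_iff'.2 fun ε hε => ?_)
  obtain ⟨n, hn⟩ := exists_pow_lt_of_lt_one hε (by norm_num : (1 / 2 : ℝ) < 1)
  refine ⟨n, fun m hm => ?_⟩
  obtain ⟨i, hi, hxi⟩ := exists_mem_piece h0 hpos hgap hx n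
  have h1 := approx_mem_Icc_of_le h0 hpos hgap hi hm hxi hx
  have h2 := approx_mem_Icc_of_le h0 hpos hgap hi le_rfl hxi hx
  refine (Real.dist_le_of_mem_Icc h1 h2).trans_lt (lt_of_eq_of_lt ?_ hn)
  rw [one_div_pow]; ring

theorem cantorFun_mem_Icc (h0 : b 0 = 1) (hpos : ∀ n, 0 < b n)
    (hgap : ∀ n, 2 * b (n + 1) < b n) {n i : ℕ} (hi : i < 2 ^ n) {x : ℝ}
    (hx : x ∈ piece b n i) (hxC : x ∈ cantorSet b) :
    cantorFun b x ∈ Icc ((i : ℝ) / 2 ^ n) ((i + 1) / 2 ^ n) :=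
  isClosed_Icc.mem_of_tendsto (tendsto_approx h0 hpos hgap hxC)
    ((eventually_ge_atTop n).mono fun _ hm => approx_mem_Icc_of_le h0 hpos hgap hi hm hx hxC)

theorem cantorFun_leftEnd (h0 : b 0 = 1) (hpos : ∀ n, 0 < b n)
    (hgap : ∀ n, 2 * b (n + 1) < b n) {n i : ℕ} (hi : i < 2 ^ n) :
    cantorFun b (1 + leftOffset b n i) = i / 2 ^ n := by
  refine tendsto_nhds_unique
    (tendsto_approx h0 hpos hgap (leftEnd_mem_cantorSet h0 hpos hgap hi))
    (tendsto_const_nhds.congr' ?_)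
  filter_upwards [eventually_ge_atTop n] with m hm
  obtain ⟨d, rfl⟩ := Nat.exists_eq_add_of_le hm
  have h := (approx_endpoints h0 hpos hgap (n := n + d) (i := i * 2 ^ d)
    (by rw [pow_add]; gcongr)).1
  rw [leftOffset_mul_two_pow] at h
  rw [h]
  push_cast
  rw [pow_add, mul_div_mul_right _ _ (by positivity)]

theorem continuousOn_cantorFun (h0 : b 0 = 1) (hpos : ∀ n, 0 < b n)
    (hgap : ∀ n, 2 * b (n + 1) < b n) : ContinuousOn (cantorFun b) (cantorSet b) := by
  intro x hx
  refine Metric.tendsto_nhds.2 fun ε hε => ?_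
  obtain ⟨n, hn⟩ := exists_pow_lt_of_lt_one hε (by norm_num : (1 / 2 : ℝ) < 1)
  obtain ⟨i, hi, hxi⟩ := exists_mem_piece h0 hpos hgap hx n
  -- Away from the other, finitely many, closed level-`n` intervals, nearby points of `C_b` share
  -- the interval of `x`, hence its dyadic range of values.
  have hcl : IsClosed (⋃ j ∈ Iio (2 ^ n) \ {i}, piece b n j) :=
    ((finite_Iio _).subset sdiff_subset).isClosed_biUnion fun j _ => isClosed_Icc
  have hx' : x ∈ (⋃ j ∈ Iio (2 ^ n) \ {i}, piece b n j)ᶜ := by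
    simp only [mem_compl_iff, mem_iUnion, not_exists]
    rintro j ⟨hj, hji⟩ hxj
    exact hji (eq_of_mem_piece hpos hgap hj hi hxj hxi)
  filter_upwards [mem_nhdsWithin_of_mem_nhds (hcl.isOpen_compl.mem_nhds hx'),
    self_mem_nhdsWithin] with y hy hyC
  obtain ⟨j, hj, hyj⟩ := exists_mem_piece h0 hpos hgap hyC n
  have hji : j = i := by
    by_contra hne
    exact hy (mem_biUnion (show j ∈ Iio (2 ^ n) \ {i} from ⟨hj, hne⟩) hyj)
  subst hji
  refine (Real.dist_le_of_mem_Icc (cantorFun_mem_Icc h0 hpos hgap hj hyj hyC)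
    (cantorFun_mem_Icc h0 hpos hgap hi hxi hx)).trans_lt (lt_of_eq_of_lt ?_ hn)
  rw [one_div_pow]; ring

/-- The left endpoints of the intervals of all levels. -/
def leftEnds (b : ℕ → ℝ) : Set ℝ := {t | ∃ n, ∃ i < 2 ^ n, t = 1 + leftOffset b n i}

theorem countable_leftEnds (b : ℕ → ℝ) : (leftEnds b).Countable := by
  refine (countable_range fun p : ℕ × ℕ => 1 + leftOffset b p.1 p.2).mono ?_
  rintro _ ⟨n, i, _, rfl⟩
  exact ⟨(n, i), rfl⟩

theorem leftEnds_subset (h0 : b 0 = 1) (hpos : ∀ n, 0 < b n)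
    (hgap : ∀ n, 2 * b (n + 1) < b n) : leftEnds b ⊆ cantorSet b := by
  rintro _ ⟨n, i, hi, rfl⟩
  exact leftEnd_mem_cantorSet h0 hpos hgap hi

theorem le_half_pow (h0 : b 0 = 1) (hgap : ∀ n, 2 * b (n + 1) < b n) (n : ℕ) :
    b n ≤ (1 / 2) ^ n := by
  induction n with
  | zero => simp [h0]
  | succ n ih => rw [pow_succ]; linarith [hgap n]

theorem cantorSet_subset_closure (h0 : b 0 = 1) (hpos : ∀ n, 0 < b n)
    (hgap : ∀ n, 2 * b (n + 1) < b n) : cantorSet b ⊆ closure (leftEnds b) := by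
  intro x hx
  refine Metric.mem_closure_iff.2 fun ε hε => ?_
  obtain ⟨n, hn⟩ := exists_pow_lt_of_lt_one hε (by norm_num : (1 / 2 : ℝ) < 1)
  obtain ⟨i, hi, hxi⟩ := exists_mem_piece h0 hpos hgap hx n
  refine ⟨_, ⟨n, i, hi, rfl⟩, ?_⟩
  have := le_half_pow h0 hgap n
  rw [Real.dist_eq, abs_of_nonneg (by linarith [hxi.1])]
  linarith [hxi.2]

theorem one_le_of_mem_cantorSet (h0 : b 0 = 1) (hpos : ∀ n, 0 < b n)
    (hgap : ∀ n, 2 * b (n + 1) < b n) {x : ℝ} (hx : x ∈ cantorSet b) : 1 ≤ x := by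
  obtain ⟨i, hi, hxi⟩ := exists_mem_piece h0 hpos hgap hx 0
  simpa [leftOffset] using hxi.1

end

/-! ### Pair sums organised by the level of separation -/

theorem leftOffset_succ_left (b : ℕ → ℝ) {m i : ℕ} (hi : i < 2 ^ m) :
    leftOffset b (m + 1) i = leftOffset (fun k => b (k + 1)) m i := by
  induction m generalizing i with
  | zero =>
    have : i = 0 := by simpa using hi
    simp [leftOffset, this]
  | succ m ih =>
    rw [leftOffset, ih (by rw [pow_succ] at hi; omega), leftOffset]

/-- `leftOffset` recurses on the last binary digit of the index; here the leading digit is removed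
instead. Each half of the tree is thus a translate of the tree for the shifted sequence, which
permits induction from the root. -/
theorem leftOffset_succ_right (b : ℕ → ℝ) {m i : ℕ} (hi : i < 2 ^ m) :
    leftOffset b (m + 1) (2 ^ m + i) =
      b 0 - b 1 + leftOffset (fun k => b (k + 1)) m i := by
  induction m generalizing i with
  | zero =>
    have : i = 0 := by simpa using hi
    simp [leftOffset, this]
  | succ m ih =>
    have h1 : (2 ^ (m + 1) + i) / 2 = 2 ^ m + i / 2 := by rw [pow_succ]; omega
    have h2 : (2 ^ (m + 1) + i) % 2 = i % 2 := by rw [pow_succ]; omega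
    rw [leftOffset, h1, h2, ih (by rw [pow_succ] at hi; omega), leftOffset]
    ring

theorem leftOffset_mem_Icc {b : ℕ → ℝ} (hb : Antitone b) (m i : ℕ) :
    leftOffset b m i ∈ Icc 0 (b 0 - b m) := by
  induction m generalizing i with
  | zero => simp [leftOffset]
  | succ m ih =>
    obtain ⟨h1, h2⟩ := ih (i / 2)
    have h3 := hb (Nat.le_succ m)
    have h4 : ((i % 2 : ℕ) : ℝ) ≤ 1 := by
      exact_mod_cast Nat.lt_succ_iff.1 (Nat.mod_lt i two_pos)
    have h5 : (0 : ℝ) ≤ ((i % 2 : ℕ) : ℝ) := by positivity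
    rw [leftOffset]
    constructor <;> nlinarith

theorem sum_reflect_right (f : ℕ → ℝ) (M i : ℕ) :
    ∑ j ∈ Finset.range M, f (i + (M - 1 - j)) = ∑ j ∈ Finset.range M, f (i + j) :=
  Finset.sum_range_reflect (fun j => f (i + j)) M

/-- The sum of an interaction `G` over all pairs of left endpoints of level `m` is controlled by
the interactions at the levels `n < m` at which the pairs separate. -/
theorem sum_sum_interaction_le {ε : ℝ} (hε : 0 < ε) (G : ℝ → ℝ → ℝ) (m : ℕ) (b : ℕ → ℝ)
    (hpos : ∀ n, 0 < b n) (hgap : ∀ n, ε * b n ≤ b n - 2 * b (n + 1)) (hb : Antitone b)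
    (g : ℕ → ℝ → ℝ) (X : ℕ → ℝ)
    (hG : ∀ n < m, ∀ τ k, ε * b n ≤ |τ| → |τ| ≤ b n → 1 ≤ |k| → G τ k ≤ g n |k|)
    (hX : ∀ n < m, ∑ i ∈ Finset.range (2 ^ (m - n - 1)), ∑ j ∈ Finset.range (2 ^ (m - n - 1)),
      g n ((1 + (i + j) : ℕ) : ℝ) ≤ X n) :
    ∑ i ∈ Finset.range (2 ^ m), ∑ j ∈ Finset.range (2 ^ m),
        G (leftOffset b m i - leftOffset b m j) (i - j) ≤
      2 ^ m * G 0 0 + ∑ n ∈ Finset.range m, 2 ^ (n + 1) * X n := by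
  induction m generalizing b g X with
  | zero => simp [leftOffset]
  | succ m ih =>
    set M := 2 ^ m with hM
    set c : ℕ → ℝ := fun k => b (k + 1) with hc
    have hcb : Antitone c := fun k l hkl => hb (by omega)
    have ih' := ih c (fun n => hpos _) (fun n => hgap _) hcb (fun n => g (n + 1))
      (fun n => X (n + 1)) (fun n hn => hG (n + 1) (by omega)) (fun n hn => by
        have := hX (n + 1) (by omega)
        rwa [show m + 1 - (n + 1) - 1 = m - n - 1 by omega] at this)
    have hX0 := hX 0 (by omega)
    rw [show m + 1 - 0 - 1 = m by omega] at hX0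
    -- Points in different halves are at least the gap `b 0 - 2 * b 1` apart, which is at least `ε *
    -- b 0`.
    have hdiff : ∀ i j, b 0 - b 1 + leftOffset c m i - leftOffset c m j ∈
        Icc (ε * b 0) (b 0) := fun i j => by
      obtain ⟨h1, h2⟩ := leftOffset_mem_Icc hcb m i
      obtain ⟨h3, h4⟩ := leftOffset_mem_Icc hcb m j
      have h5 := hpos (m + 1)
      have h6 := hgap 0
      simp only [hc, zero_add] at h2 h4 h6
      constructor <;> linarith
    have hε0 : ∀ i j, 0 ≤ b 0 - b 1 + leftOffset c m i - leftOffset c m j := fun i j =>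
      (mul_pos hε (hpos 0)).le.trans (hdiff i j).1
    -- Reflecting `j` to `M - 1 - j` turns the index difference `M + i - j` into one plus a sum of
    -- two free indices. The two inequalities are the two orders of the pair; together they account
    -- for the extra factor 2 in `2 ^ (n + 1)`.
    have hcross : ∀ i < M, ∀ j < M,
        G (b 0 - b 1 + leftOffset c m i - leftOffset c m j) ((M + i : ℕ) - (j : ℝ)) ≤
          g 0 ((1 + (i + (M - 1 - j)) : ℕ) : ℝ) ∧
        G (leftOffset c m j - (b 0 - b 1 + leftOffset c m i)) ((j : ℝ) - (M + i : ℕ)) ≤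
          g 0 ((1 + (i + (M - 1 - j)) : ℕ) : ℝ) := fun i hi j hj => by
      have e : ((1 + (i + (M - 1 - j)) : ℕ) : ℝ) = (M + i : ℕ) - (j : ℝ) := by
        rw [← Nat.cast_sub (by omega)]
        congr 1; omega
      have h1 : (1 : ℝ) ≤ (1 + (i + (M - 1 - j)) : ℕ) := by
        exact_mod_cast Nat.le_add_right _ _
      have hd := hdiff i j
      have h0 := hε0 i j
      rw [← neg_sub ((M + i : ℕ) : ℝ) (j : ℝ), ← e,
        ← neg_sub (b 0 - b 1 + leftOffset c m i) (leftOffset c m j)]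
      constructor
      · have := hG 0 (by omega) (b 0 - b 1 + leftOffset c m i - leftOffset c m j)
          ((1 + (i + (M - 1 - j)) : ℕ) : ℝ)
        rw [abs_of_nonneg h0, abs_of_nonneg (by linarith)] at this
        exact this hd.1 hd.2 h1
      · have := hG 0 (by omega) (-(b 0 - b 1 + leftOffset c m i - leftOffset c m j))
          (-((1 + (i + (M - 1 - j)) : ℕ) : ℝ))
        rw [abs_neg, abs_neg, abs_of_nonneg h0, abs_of_nonneg (by linarith)] at this
        exact this hd.1 hd.2 h1
    have hsum : ∑ i ∈ Finset.range M, ∑ j ∈ Finset.range M,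
        g 0 ((1 + (i + (M - 1 - j)) : ℕ) : ℝ) ≤ X 0 := by
      refine le_trans (le_of_eq (Finset.sum_congr rfl fun i _ => ?_)) hX0
      exact sum_reflect_right (fun k => g 0 ((1 + k : ℕ) : ℝ)) M i
    have hLL : ∑ i ∈ Finset.range M, ∑ j ∈ Finset.range M,
        G (leftOffset b (m + 1) i - leftOffset b (m + 1) j) ((i : ℝ) - j) =
        ∑ i ∈ Finset.range M, ∑ j ∈ Finset.range M,
          G (leftOffset c m i - leftOffset c m j) ((i : ℝ) - j) := by
      refine Finset.sum_congr rfl fun i hi => Finset.sum_congr rfl fun j hj => ?_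
      rw [leftOffset_succ_left b (Finset.mem_range.1 hi),
        leftOffset_succ_left b (Finset.mem_range.1 hj)]
    have hRR : ∑ i ∈ Finset.range M, ∑ j ∈ Finset.range M,
        G (leftOffset b (m + 1) (M + i) - leftOffset b (m + 1) (M + j))
          (((M + i : ℕ) : ℝ) - (M + j : ℕ)) =
        ∑ i ∈ Finset.range M, ∑ j ∈ Finset.range M,
          G (leftOffset c m i - leftOffset c m j) ((i : ℝ) - j) := by
      refine Finset.sum_congr rfl fun i hi => Finset.sum_congr rfl fun j hj => ?_
      rw [leftOffset_succ_right b (Finset.mem_range.1 hi),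
        leftOffset_succ_right b (Finset.mem_range.1 hj), add_sub_add_left_eq_sub]
      push_cast
      rw [add_sub_add_left_eq_sub]
    have hRL : ∑ i ∈ Finset.range M, ∑ j ∈ Finset.range M,
        G (leftOffset b (m + 1) (M + i) - leftOffset b (m + 1) j)
          (((M + i : ℕ) : ℝ) - j) ≤ X 0 := by
      refine le_trans (Finset.sum_le_sum fun i hi => Finset.sum_le_sum fun j hj => ?_) hsum
      rw [Finset.mem_range] at hi hj
      rw [leftOffset_succ_right b hi, leftOffset_succ_left b hj]
      exact (hcross i hi j hj).1
    have hLR : ∑ i ∈ Finset.range M, ∑ j ∈ Finset.range M,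
        G (leftOffset b (m + 1) i - leftOffset b (m + 1) (M + j))
          ((i : ℝ) - (M + j : ℕ)) ≤ X 0 := by
      rw [Finset.sum_comm]
      refine le_trans (Finset.sum_le_sum fun i hi => Finset.sum_le_sum fun j hj => ?_) hsum
      rw [Finset.mem_range] at hi hj
      rw [leftOffset_succ_right b hi, leftOffset_succ_left b hj]
      exact (hcross i hi j hj).2
    have hsplit : 2 ^ (m + 1) = M + M := by rw [pow_succ]; omega
    rw [Finset.sum_range_succ' _ m]
    simp only [hsplit, Finset.sum_range_add, Finset.sum_add_distrib]
    rw [hLL, hRR]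
    have hshift : ∑ n ∈ Finset.range m, (2 : ℝ) ^ (n + 1 + 1) * X (n + 1) =
        2 * ∑ n ∈ Finset.range m, 2 ^ (n + 1) * X (n + 1) := by
      rw [Finset.mul_sum]
      exact Finset.sum_congr rfl fun n _ => by ring
    rw [hshift, pow_succ, zero_add, pow_one]
    linarith

/-! ### Uniform bound on the interaction sums -/

theorem sum_one_div_sq_le {r : ℝ} (hr : 0 < r) (M : ℕ) :
    ∑ i ∈ Finset.range M, 1 / (1 + r * (i + 1)) ^ 2 ≤ 1 / r := by
  have key : ∀ M : ℕ, ∑ i ∈ Finset.range M, 1 / (1 + r * (i + 1)) ^ 2 ≤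
      1 / r * (1 - 1 / (1 + r * M)) := fun M => by
    induction M with
    | zero => simp
    | succ M ih =>
      rw [Finset.sum_range_succ]
      push_cast
      have h1 : 0 < 1 + r * M := by positivity
      have h2 : 0 < 1 + r * (M + 1) := by positivity
      -- Replacing one factor of the square by its predecessor makes the sum telescope.
      have h3 : 1 / (1 + r * (M + 1)) ^ 2 ≤ 1 / ((1 + r * M) * (1 + r * (M + 1))) := by
        rw [sq]
        gcongr
        linarith
      have h4 : 1 / ((1 + r * M) * (1 + r * (M + 1))) =
          1 / r * (1 / (1 + r * M) - 1 / (1 + r * (M + 1))) := by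
        field_simp
        ring
      linarith
  refine (key M).trans (mul_le_of_le_one_right (by positivity) ?_)
  have : 0 ≤ 1 / (1 + r * M) := by positivity
  linarith

/-- The fourth power dominates a product of two squares, one in `i` and one in `j`, so the double
sum factors. -/
theorem sum_sum_one_div_pow_four_le {r : ℝ} (hr : 0 < r) (M : ℕ) :
    ∑ i ∈ Finset.range M, ∑ j ∈ Finset.range M, 1 / (1 + r * ((1 + (i + j) : ℕ) : ℝ)) ^ 4 ≤
      1 / r ^ 2 := by
  calc _ ≤ ∑ i ∈ Finset.range M, ∑ j ∈ Finset.range M,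
        1 / (1 + r * (i + 1)) ^ 2 * (1 / (1 + r * (j + 1)) ^ 2) := by
        refine Finset.sum_le_sum fun i _ => Finset.sum_le_sum fun j _ => ?_
        rw [one_div_mul_one_div, show 4 = 2 + 2 from rfl, pow_add]
        push_cast
        have hi : (0 : ℝ) ≤ r * i := by positivity
        have hj : (0 : ℝ) ≤ r * j := by positivity
        gcongr 1 / (?_ ^ 2 * ?_ ^ 2) <;> linarith
    _ = (∑ i ∈ Finset.range M, 1 / (1 + r * (i + 1)) ^ 2) ^ 2 := by
        rw [sq, Finset.sum_mul_sum]
    _ ≤ (1 / r) ^ 2 := by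
        have : 0 ≤ ∑ i ∈ Finset.range M, 1 / (1 + r * ((i : ℝ) + 1)) ^ 2 :=
          Finset.sum_nonneg fun i _ => by positivity
        gcongr
        exact sum_one_div_sq_le hr M
    _ = 1 / r ^ 2 := by rw [one_div_pow]

/-- Polynomial decay of order four suffices for the double sum. The constant is `8 * 128`, from `(1
+ x) ^ 4 ≤ 8 * (1 + x ^ 4)` and `exp (x ^ 2 / 8) ≥ 1 + x ^ 4 / 128`. -/
theorem exp_neg_sq_div_eight_le {x : ℝ} (hx : 0 ≤ x) :
    Real.exp (-(x ^ 2 / 8)) ≤ 1024 / (1 + x) ^ 4 := by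
  have h1 : 1 + (x ^ 2 / 8) ^ 2 / 2 ≤ Real.exp (x ^ 2 / 8) := by
    have := Real.quadratic_le_exp_of_nonneg (show 0 ≤ x ^ 2 / 8 by positivity)
    have : 0 ≤ x ^ 2 / 8 := by positivity
    linarith
  have h2 : (1 + x) ^ 4 ≤ 8 * (1 + x ^ 4) := by
    nlinarith [sq_nonneg (x - 1), sq_nonneg (x ^ 2 - 1), sq_nonneg (x * (x - 1)),
      mul_nonneg hx (sq_nonneg (x - 1))]
  rw [Real.exp_neg, inv_eq_one_div, div_le_div_iff₀ (Real.exp_pos _) (by positivity)]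
  have : 0 ≤ x ^ 4 := by positivity
  nlinarith

/-- The interaction bounding the probability that two of the events of the second moment argument
at mesh `h` occur simultaneously. -/
noncomputable def interaction (h τ k : ℝ) : ℝ :=
  if k = 0 then h / 2 else h ^ 2 / 2 * ((√|τ|)⁻¹ * Real.exp (-((k * h) ^ 2 / (8 * |τ|))))

theorem interaction_le_of_abs_mem {h τ k ε β : ℝ} (hε : 0 < ε) (hβ : 0 < β) (h1 : ε * β ≤ |τ|)
    (h2 : |τ| ≤ β) (hk : 1 ≤ |k|) :
    interaction h τ k ≤
      h ^ 2 / 2 * ((√(ε * β))⁻¹ * Real.exp (-((|k| * h) ^ 2 / (8 * β)))) := by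
  have hk0 : k ≠ 0 := by
    rintro rfl
    simp at hk
    linarith
  have h3 : 0 < ε * β := mul_pos hε hβ
  have h4 : 0 < |τ| := h3.trans_le h1
  rw [interaction, if_neg hk0, mul_pow |k|, sq_abs, ← mul_pow]
  gcongr

theorem two_pow_mul_sqrt_lengths {a : ℕ → ℝ} (ha : ∀ n, 0 < a n) (n : ℕ) :
    2 ^ n * √(lengths a n) = a n := by
  have := ha n
  rw [lengths, Real.sqrt_sq (by positivity), ← mul_assoc, zpow_neg, zpow_natCast,
    mul_inv_cancel₀ (by positivity), one_mul]

theorem lengths_pos {a : ℕ → ℝ} (ha : ∀ n, 0 < a n) (n : ℕ) : 0 < lengths a n := by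
  have := ha n
  rw [lengths]
  positivity

theorem lengths_gap {a : ℕ → ℝ} {ε : ℝ}
    (hstep : ∀ n, a n ^ 2 - 1 / 2 * a (n + 1) ^ 2 ≥ ε * a n ^ 2) (n : ℕ) :
    ε * lengths a n ≤ lengths a n - 2 * lengths a (n + 1) := by
  have e : ∀ k, lengths a k = a k ^ 2 / 4 ^ k := fun k => by
    rw [lengths, mul_pow, zpow_neg, zpow_natCast, inv_pow, ← pow_mul, mul_comm k 2, pow_mul]
    norm_num
    field_simp
  rw [e, e, pow_succ]
  have h4 : (0 : ℝ) < 4 ^ n := by positivity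
  have h := div_le_div_of_nonneg_right (hstep n) h4.le
  calc ε * (a n ^ 2 / 4 ^ n) = ε * a n ^ 2 / 4 ^ n := by ring
    _ ≤ _ := h
    _ = _ := by field_simp; ring

theorem antitone_of_gap {b : ℕ → ℝ} {ε : ℝ} (hε : 0 < ε) (hpos : ∀ n, 0 < b n)
    (hgap : ∀ n, ε * b n ≤ b n - 2 * b (n + 1)) : Antitone b :=
  antitone_nat_of_succ_le fun n => by
    have := hgap n
    have := mul_pos hε (hpos n)
    linarith [hpos (n + 1)]

theorem exists_interaction_sum_le {a : ℕ → ℝ} (ha : ∀ n, 0 < a n) {ε : ℝ} (hε : 0 < ε)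
    (hstep : ∀ n, a n ^ 2 - 1 / 2 * a (n + 1) ^ 2 ≥ ε * a n ^ 2)
    (hsum : Summable a ∨ Summable (fun n => 1 / a n)) :
    ∃ K : ℝ, 0 < K ∧ ∀ m : ℕ, ∑ i ∈ Finset.range (2 ^ m), ∑ j ∈ Finset.range (2 ^ m),
      interaction (1 / 2 ^ m) (leftOffset (lengths a) m i - leftOffset (lengths a) m j) (i - j)
        ≤ K := by
  set b := lengths a with hb
  have hpos := lengths_pos ha
  have hgap := lengths_gap hstep
  have hsqrt : ∀ n, 2 ^ n * √(b n) = a n := two_pow_mul_sqrt_lengths ha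
  have hanti := antitone_of_gap hε hpos hgap
  have hdiag : ∀ m : ℕ, (2 : ℝ) ^ m * interaction (1 / 2 ^ m) 0 0 = 1 / 2 := fun m => by
    rw [interaction, if_pos rfl]
    field_simp
  rcases hsum with hs | hs
  · have hT : 0 ≤ ∑' n, a n := tsum_nonneg fun n => (ha n).le
    refine ⟨1 / 2 + 1024 / √ε * ∑' n, a n, by positivity, fun m => ?_⟩
    set h : ℝ := 1 / 2 ^ m with hh
    have h0 : 0 < h := by positivity
    -- Summable `a`: the Gaussian decay in `k` has scale `√(b n) / h`, so the double sum costs `b n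
    -- / h ^ 2` and the mesh cancels.
    refine (sum_sum_interaction_le hε (interaction h) m b hpos hgap hanti
      (fun n k => h ^ 2 / 2 * ((√(ε * b n))⁻¹ * (1024 * (1 / (1 + h / √(b n) * k) ^ 4))))
      (fun n => 512 / √ε * √(b n)) ?_ ?_).trans ?_
    · intro n _ τ k h1 h2 hk
      refine (interaction_le_of_abs_mem hε (hpos n) h1 h2 hk).trans ?_
      have : 0 < b n := hpos n
      have e : (|k| * h) ^ 2 / (8 * b n) = (h / √(b n) * |k|) ^ 2 / 8 := by
        rw [mul_pow, mul_pow, div_pow h, Real.sq_sqrt this.le]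
        field_simp
      rw [e, mul_one_div]
      gcongr
      exact exp_neg_sq_div_eight_le (by positivity)
    · intro n _
      have := hpos n
      simp only [← Finset.mul_sum]
      refine (mul_le_mul_of_nonneg_left (mul_le_mul_of_nonneg_left (mul_le_mul_of_nonneg_left
        (sum_sum_one_div_pow_four_le (r := h / √(b n)) (by positivity) _) (by norm_num))
        (by positivity)) (by positivity)).trans (le_of_eq ?_)
      rw [Real.sqrt_mul hε.le]
      have h1 : 0 < √(b n) := Real.sqrt_pos.2 this
      field_simp
      norm_num
    · rw [hdiag]
      gcongr
      calc _ = ∑ n ∈ Finset.range m, 1024 / √ε * a n := by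
            refine Finset.sum_congr rfl fun n _ => ?_
            rw [← hsqrt n]; ring
        _ = 1024 / √ε * ∑ n ∈ Finset.range m, a n := by rw [Finset.mul_sum]
        _ ≤ _ := by
            gcongr
            exact hs.sum_le_tsum _ fun n _ => (ha n).le
  · have hT : 0 ≤ ∑' n, 1 / a n := tsum_nonneg fun n => by have := ha n; positivity
    refine ⟨1 / 2 + 1 / √ε * ∑' n, 1 / a n, by positivity, fun m => ?_⟩
    set h : ℝ := 1 / 2 ^ m with hh
    have h0 : 0 < h := by positivity
    -- Summable `1 / a`: the exponential is bounded by 1, and `4 ^ (m - n - 1)` pairs times `h ^ 2 /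
    -- 2` give the factor `1 / (8 * 4 ^ n)`.
    refine (sum_sum_interaction_le hε (interaction h) m b hpos hgap hanti
      (fun n _ => h ^ 2 / 2 * (√(ε * b n))⁻¹)
      (fun n => 1 / √ε * (1 / (8 * 2 ^ n * (2 ^ n * √(b n))))) ?_ ?_).trans ?_
    · intro n _ τ k h1 h2 hk
      refine (interaction_le_of_abs_mem hε (hpos n) h1 h2 hk).trans ?_
      have := hpos n
      gcongr
      refine mul_le_of_le_one_right (by positivity) (Real.exp_le_one_iff.2 ?_)
      rw [neg_nonpos]
      positivity
    · intro n hn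
      have := hpos n
      have h1 : 0 < √(b n) := Real.sqrt_pos.2 this
      simp only [Finset.sum_const, Finset.card_range, nsmul_eq_mul]
      obtain ⟨d, rfl⟩ := Nat.exists_eq_add_of_lt hn
      rw [show n + d + 1 - n - 1 = d by omega, Real.sqrt_mul hε.le, hh]
      refine le_of_eq ?_
      push_cast
      field_simp
      ring
    · rw [hdiag]
      gcongr
      calc _ = ∑ n ∈ Finset.range m, 1 / √ε * (1 / 4 * (1 / a n)) := by
            refine Finset.sum_congr rfl fun n _ => ?_
            have := ha n
            rw [hsqrt n]; field_simp; ring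
        _ ≤ ∑ n ∈ Finset.range m, 1 / √ε * (1 / a n) := by
            refine Finset.sum_le_sum fun n _ => ?_
            have : 0 < 1 / a n := one_div_pos.2 (ha n)
            gcongr
            linarith
        _ = 1 / √ε * ∑ n ∈ Finset.range m, 1 / a n := by rw [Finset.mul_sum]
        _ ≤ _ := by
            gcongr
            exact hs.sum_le_tsum _ fun n _ => (one_div_pos.2 (ha n)).le

/-! ### Gaussian density estimates -/

theorem gaussianReal_Icc_eq {v : ℝ≥0} (hv : v ≠ 0) (l u : ℝ) :
    (gaussianReal 0 v).real (Icc l u) = ∫ x in Icc l u, gaussianPDFReal 0 v x := by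
  rw [measureReal_def, gaussianReal_apply_eq_integral 0 hv, ENNReal.toReal_ofReal]
  exact integral_nonneg fun x => gaussianPDFReal_nonneg 0 v x

theorem gaussianReal_Icc_le {v : ℝ≥0} (hv : v ≠ 0) {l u C : ℝ} (hlu : l ≤ u)
    (hC : ∀ x ∈ Icc l u, gaussianPDFReal 0 v x ≤ C) :
    (gaussianReal 0 v).real (Icc l u) ≤ C * (u - l) := by
  rw [gaussianReal_Icc_eq hv]
  refine (setIntegral_mono_on (integrable_gaussianPDFReal 0 v).integrableOn
    (integrableOn_const (by simp)) measurableSet_Icc hC).trans (le_of_eq ?_)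
  rw [setIntegral_const, Real.volume_real_Icc_of_le hlu, smul_eq_mul, mul_comm]

theorem le_gaussianReal_Icc {v : ℝ≥0} (hv : v ≠ 0) {l u C : ℝ} (hlu : l ≤ u)
    (hC : ∀ x ∈ Icc l u, C ≤ gaussianPDFReal 0 v x) :
    C * (u - l) ≤ (gaussianReal 0 v).real (Icc l u) := by
  rw [gaussianReal_Icc_eq hv]
  refine (le_of_eq ?_).trans (setIntegral_mono_on (integrableOn_const (by simp))
    (integrable_gaussianPDFReal 0 v).integrableOn measurableSet_Icc hC)
  rw [setIntegral_const, Real.volume_real_Icc_of_le hlu, smul_eq_mul, mul_comm]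

theorem inv_sqrt_two_pi_mul_le {v : ℝ} (hv : 0 < v) : (√(2 * Real.pi * v))⁻¹ ≤ (√v)⁻¹ := by
  gcongr
  have := Real.pi_gt_three
  nlinarith

theorem gaussianPDFReal_le_one {v : ℝ≥0} (hv : 1 ≤ v) (x : ℝ) : gaussianPDFReal 0 v x ≤ 1 := by
  have hv' : (1 : ℝ) ≤ v := hv
  rw [gaussianPDFReal]
  refine mul_le_one₀ ?_ (Real.exp_nonneg _) (Real.exp_le_one_iff.2 ?_)
  · exact (inv_sqrt_two_pi_mul_le (by linarith)).trans (inv_le_one_of_one_le₀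
      (Real.one_le_sqrt.2 hv'))
  · rw [neg_div, neg_nonpos]
    positivity

theorem gaussianPDFReal_le {v : ℝ≥0} (hv : v ≠ 0) {u x : ℝ} (hu : 0 ≤ u) (hx : u / 2 ≤ x) :
    gaussianPDFReal 0 v x ≤ (√v)⁻¹ * Real.exp (-(u ^ 2 / (8 * v))) := by
  have hv' : (0 : ℝ) < v := NNReal.coe_pos.2 (pos_of_ne_zero hv)
  rw [gaussianPDFReal]
  refine mul_le_mul (inv_sqrt_two_pi_mul_le hv') (Real.exp_le_exp.2 ?_) (Real.exp_nonneg _)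
    (by positivity)
  rw [neg_div, neg_le_neg_iff, sub_zero, div_le_div_iff₀ (by positivity) (by positivity)]
  have h1 : u ^ 2 ≤ 4 * x ^ 2 := by nlinarith
  nlinarith

/-- The bound `5 / 4` covers a target value in `[0, 1]` with tolerance at most `1 / 4`. -/
theorem le_gaussianPDFReal {v : ℝ≥0} (h1 : 1 ≤ v) (h2 : v ≤ 2) {x : ℝ} (hx : |x| ≤ 5 / 4) :
    (√(4 * Real.pi))⁻¹ * Real.exp (-1) ≤ gaussianPDFReal 0 v x := by
  have h1' : (1 : ℝ) ≤ v := h1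
  have h2' : (v : ℝ) ≤ 2 := h2
  have hpi := Real.pi_pos
  rw [gaussianPDFReal]
  refine mul_le_mul ?_ (Real.exp_le_exp.2 ?_) (Real.exp_nonneg _) (by positivity)
  · gcongr ?_⁻¹
    exact Real.sqrt_le_sqrt (by nlinarith)
  · rw [neg_div, neg_le_neg_iff, sub_zero, div_le_one (by positivity)]
    have := abs_le.1 hx
    nlinarith

/-! ### Reduction of the hitting event to countably many times -/

section Events

variable {Ω : Type*} {B : ℝ≥0 → Ω → ℝ} {b : ℕ → ℝ}

/-- The event that `B` is within `2⁻ⁿ / 4` of the generalized Cantor function at the left endpoint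
of the `i`-th interval of level `n`. -/
def nearEvent (B : ℝ≥0 → Ω → ℝ) (b : ℕ → ℝ) (n i : ℕ) : Set Ω :=
  {ω | |B (1 + leftOffset b n i).toNNReal ω - i / 2 ^ n| ≤ 1 / 2 ^ n / 4}

/-- The event that `B` is within `1 / (k + 1)` of the generalized Cantor function at some left
endpoint. -/
def closeEvent (B : ℝ≥0 → Ω → ℝ) (b : ℕ → ℝ) (k : ℕ) : Set Ω :=
  ⋃ t ∈ leftEnds b, {ω | |B t.toNNReal ω - cantorFun b t| < 1 / ((k : ℝ) + 1)}

theorem antitone_closeEvent : Antitone (closeEvent B b) := fun k l hkl =>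
  biUnion_mono subset_rfl fun _ _ _ hω => lt_of_lt_of_le (mem_ofPred_eq.mp hω) (by gcongr)

theorem biUnion_nearEvent_subset (h0 : b 0 = 1) (hpos : ∀ n, 0 < b n)
    (hgap : ∀ n, 2 * b (n + 1) < b n) {n k : ℕ} (hn : (1 / 2 : ℝ) ^ n < 1 / ((k : ℝ) + 1)) :
    ⋃ i ∈ Finset.range (2 ^ n), nearEvent B b n i ⊆ closeEvent B b k := by
  refine iUnion₂_subset fun i hi ω hω => ?_
  rw [Finset.mem_range] at hi
  refine mem_biUnion (show _ ∈ leftEnds b from ⟨n, i, hi, rfl⟩) ?_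
  rw [mem_ofPred_eq, cantorFun_leftEnd h0 hpos hgap hi]
  have hω' : |B (1 + leftOffset b n i).toNNReal ω - i / 2 ^ n| ≤ 1 / 2 ^ n / 4 := hω
  have : (0 : ℝ) < 1 / 2 ^ n := by positivity
  rw [one_div_pow] at hn
  linarith

/-- A zero in `C_b` is approximated by left endpoints through density and continuity. Conversely,
`|w - f_b|` attains its minimum on the compact `C_b`, and that minimum is then 0. -/
theorem nonempty_zeros_inter_cantorSet_iff (h0 : b 0 = 1) (hpos : ∀ n, 0 < b n)
    (hgap : ∀ n, 2 * b (n + 1) < b n) {w : ℝ≥0 → ℝ} (hw : Continuous w) :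
    (zeros (fun t => w t.toNNReal - cantorFun b t) ∩ cantorSet b).Nonempty ↔
      ∀ k : ℕ, ∃ t ∈ leftEnds b, |w t.toNNReal - cantorFun b t| < 1 / ((k : ℝ) + 1) := by
  set φ : ℝ → ℝ := fun t => |w t.toNNReal - cantorFun b t| with hφ
  have hcont : ContinuousOn φ (cantorSet b) :=
    ((hw.comp continuous_real_toNNReal).continuousOn.sub
      (continuousOn_cantorFun h0 hpos hgap)).abs
  constructor
  · rintro ⟨t, ⟨_, ht0⟩, htC⟩ k
    have hφt : φ t = 0 := by simp only [hφ, ht0, abs_zero]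
    have hev : ∀ᶠ x in 𝓝[leftEnds b] t, φ x < 1 / ((k : ℝ) + 1) :=
      ((hcont t htC).mono (leftEnds_subset h0 hpos hgap)).eventually_lt_const
        (by rw [hφt]; positivity)
    have : (𝓝[leftEnds b] t).NeBot :=
      mem_closure_iff_nhdsWithin_neBot.1 (cantorSet_subset_closure h0 hpos hgap htC)
    obtain ⟨x, hx1, hx2⟩ := (hev.and self_mem_nhdsWithin).exists
    exact ⟨x, hx2, hx1⟩
  · intro h
    have hne : (cantorSet b).Nonempty :=
      ⟨_, leftEnd_mem_cantorSet h0 hpos hgap (n := 0) (i := 0) (by simp)⟩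
    obtain ⟨t, htC, hmin⟩ := (isCompact_cantorSet h0).exists_isMinOn hne hcont
    refine ⟨t, ⟨by linarith [one_le_of_mem_cantorSet h0 hpos hgap htC], ?_⟩, htC⟩
    refine abs_nonpos_iff.1 (le_of_forall_pos_lt_add fun δ hδ => ?_)
    obtain ⟨k, hk⟩ := exists_nat_one_div_lt hδ
    obtain ⟨x, hx, hxk⟩ := h k
    have := isMinOn_iff.1 hmin x (leftEnds_subset h0 hpos hgap hx)
    rw [zero_add]
    exact this.trans_lt (hxk.trans hk)

end Events

/-! ### Second moment inequality -/

section SecondMoment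

variable {Ω : Type*} [MeasurableSpace Ω]

/-- If `Z` counts the events that occur, then `2 * r * Z - r ^ 2 * Z ^ 2` is at most the indicator
of `Z > 0`, because `(r * Z - 1) ^ 2 ≥ 0`. Integrating gives the bound; the free `r` avoids dividing
by the second moment. -/
theorem le_measureReal_biUnion {ι : Type*} (P : Measure Ω) [IsProbabilityMeasure P]
    (s : Finset ι) {A : ι → Set Ω} (hA : ∀ i, NullMeasurableSet (A i) P) (r : ℝ) :
    2 * r * ∑ i ∈ s, P.real (A i) - r ^ 2 * ∑ i ∈ s, ∑ j ∈ s, P.real (A i ∩ A j) ≤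
      P.real (⋃ i ∈ s, A i) := by
  have hint : ∀ E : Set Ω, NullMeasurableSet E P →
      Integrable (E.indicator (fun _ => (1 : ℝ))) P := fun E hE =>
    (integrable_const 1).indicator₀ hE
  have hval : ∀ E : Set Ω, NullMeasurableSet E P →
      ∫ ω, E.indicator (fun _ => (1 : ℝ)) ω ∂P = P.real E := fun E hE => by
    rw [integral_indicator₀ hE, setIntegral_const, smul_eq_mul, mul_one]
  have hU : NullMeasurableSet (⋃ i ∈ s, A i) P :=
    NullMeasurableSet.biUnion s.countable_toSet fun i _ => hA i
  rw [← hval _ hU]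
  have hI1 : Integrable (fun ω => ∑ i ∈ s, (A i).indicator (fun _ => (1 : ℝ)) ω) P :=
    integrable_finsetSum _ fun i _ => hint _ (hA i)
  have hI2 : Integrable (fun ω => ∑ i ∈ s, ∑ j ∈ s,
      (A i ∩ A j).indicator (fun _ => (1 : ℝ)) ω) P :=
    integrable_finsetSum _ fun i _ => integrable_finsetSum _ fun j _ =>
      hint _ ((hA i).inter (hA j))
  have e1 : ∑ i ∈ s, P.real (A i) =
      ∫ ω, ∑ i ∈ s, (A i).indicator (fun _ => (1 : ℝ)) ω ∂P := by
    rw [integral_finsetSum _ fun i _ => hint _ (hA i)]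
    exact Finset.sum_congr rfl fun i _ => (hval _ (hA i)).symm
  have e2 : ∑ i ∈ s, ∑ j ∈ s, P.real (A i ∩ A j) =
      ∫ ω, ∑ i ∈ s, ∑ j ∈ s, (A i ∩ A j).indicator (fun _ => (1 : ℝ)) ω ∂P := by
    rw [integral_finsetSum _ fun i _ => integrable_finsetSum _ fun j _ =>
      hint _ ((hA i).inter (hA j))]
    refine Finset.sum_congr rfl fun i _ => ?_
    rw [integral_finsetSum _ fun j _ => hint _ ((hA i).inter (hA j))]
    exact Finset.sum_congr rfl fun j _ => (hval _ ((hA i).inter (hA j))).symm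
  rw [e1, e2, ← integral_const_mul, ← integral_const_mul,
    ← integral_sub (hI1.const_mul _) (hI2.const_mul _)]
  refine integral_mono ((hI1.const_mul _).sub (hI2.const_mul _)) (hint _ hU) fun ω => ?_
  have e3 : ∑ i ∈ s, ∑ j ∈ s, (A i ∩ A j).indicator (fun _ => (1 : ℝ)) ω =
      (∑ i ∈ s, (A i).indicator (fun _ => (1 : ℝ)) ω) ^ 2 := by
    rw [sq, Finset.sum_mul_sum]
    refine Finset.sum_congr rfl fun i _ => Finset.sum_congr rfl fun j _ => ?_
    by_cases hi : ω ∈ A i <;> by_cases hj : ω ∈ A j <;> simp [hi, hj]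
  simp only [e3]
  set Z := ∑ i ∈ s, (A i).indicator (fun _ => (1 : ℝ)) ω with hZ
  by_cases hω : ω ∈ ⋃ i ∈ s, A i
  · rw [indicator_of_mem hω]
    nlinarith [sq_nonneg (r * Z - 1)]
  · have : Z = 0 := Finset.sum_eq_zero fun i hi =>
      indicator_of_notMem (fun h => hω (mem_biUnion (Finset.mem_coe.2 hi) h)) _
    rw [indicator_of_notMem hω, this]
    simp

end SecondMoment

/-! ### Moments of the near events for Brownian motion -/

section Brownian

variable {Ω : Type*} [MeasurableSpace Ω] {P : Measure Ω} {B : ℝ≥0 → Ω → ℝ}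

theorem measureReal_abs_sub_le {X : Ω → ℝ} {v : ℝ≥0} (hX : HasLaw X (gaussianReal 0 v) P)
    (y δ : ℝ) :
    P.real {ω | |X ω - y| ≤ δ} = (gaussianReal 0 v).real (Icc (y - δ) (y + δ)) := by
  rw [measureReal_def, measureReal_def, ← hX.map_eq,
    Measure.map_apply_of_aemeasurable hX.aemeasurable measurableSet_Icc]
  congr 2
  ext ω
  rw [mem_preimage, mem_ofPred_eq, abs_sub_comm, mem_Icc_iff_abs_le]

theorem nullMeasurableSet_abs_sub_le {X : Ω → ℝ} (hX : AEMeasurable X P) (y δ : ℝ) :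
    NullMeasurableSet {ω | |X ω - y| ≤ δ} P :=
  nullMeasurableSet_le (hX.sub_const y).abs aemeasurable_const

/-- Both events force the independent increment to be within `h / 2` of `u`. As `h ≤ u`, it is then
at least `u / 2`, whence the exponent `u ^ 2 / 8`. The density of `B s` is at most 1 because `s ≥
1`. -/
theorem measureReal_inter_le (hB : IsPreBrownianReal B P) {s t : ℝ≥0} (hs : 1 ≤ s) (hst : s < t)
    {h u y : ℝ} (hh : 0 < h) (hu : h ≤ u) :
    P.real ({ω | |B s ω - y| ≤ h / 4} ∩ {ω | |B t ω - (y + u)| ≤ h / 4}) ≤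
      h ^ 2 / 2 * ((√((t : ℝ) - s))⁻¹ * Real.exp (-(u ^ 2 / (8 * ((t : ℝ) - s))))) := by
  have : IsProbabilityMeasure P := hB.isGaussianProcess.isProbabilityMeasure
  have hind := hB.hasIndepIncrements.indepFun_eval_sub (r := 0) zero_le hst.le
    hB.eval_zero_ae_eq_zero
  have hlaw := hB.hasLaw_sub t s
  have hts : (0 : ℝ) < t - s := sub_pos.2 (NNReal.coe_lt_coe.2 hst)
  have hvar : ((nndist t.1 s.1 : ℝ≥0) : ℝ) = t - s := by
    rw [coe_nndist, Real.dist_eq]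
    exact abs_of_pos hts
  have hne : nndist t.1 s.1 ≠ 0 := by
    rw [← NNReal.coe_ne_zero, hvar]
    exact hts.ne'
  have hsub : {ω | |B s ω - y| ≤ h / 4} ∩ {ω | |B t ω - (y + u)| ≤ h / 4} ⊆
      B s ⁻¹' {x | |x - y| ≤ h / 4} ∩ (B t - B s) ⁻¹' {x | |x - u| ≤ h / 2} := by
    rintro ω ⟨h1, h2⟩
    refine ⟨h1, ?_⟩
    simp only [mem_ofPred_eq, mem_preimage, Pi.sub_apply, abs_le] at h1 h2 ⊢
    constructor <;> linarith
  have hprod := hind.measure_inter_preimage_eq_mul {x | |x - y| ≤ h / 4} {x | |x - u| ≤ h / 2}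
    (measurableSet_le (by fun_prop) (by fun_prop)) (measurableSet_le (by fun_prop) (by fun_prop))
  have h1 : P.real (B s ⁻¹' {x | |x - y| ≤ h / 4}) ≤ h / 2 := by
    change P.real {ω | |B s ω - y| ≤ h / 4} ≤ h / 2
    rw [measureReal_abs_sub_le (hB.hasLaw_eval s)]
    refine (gaussianReal_Icc_le (C := 1) (by positivity) (by linarith)
      fun x _ => gaussianPDFReal_le_one hs x).trans (le_of_eq (by ring))
  have h2 : P.real ((B t - B s) ⁻¹' {x | |x - u| ≤ h / 2}) ≤
      (√((t : ℝ) - s))⁻¹ * Real.exp (-(u ^ 2 / (8 * ((t : ℝ) - s)))) * h := by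
    change P.real {ω | |(B t - B s) ω - u| ≤ h / 2} ≤ _
    rw [measureReal_abs_sub_le hlaw, ← hvar]
    refine (gaussianReal_Icc_le hne (by linarith) fun x hx =>
      gaussianPDFReal_le hne (u := u) (by linarith) (by linarith [hx.1])).trans (le_of_eq (by ring))
  refine (measureReal_mono hsub).trans ?_
  rw [measureReal_def, hprod, ENNReal.toReal_mul]
  refine (mul_le_mul h1 h2 measureReal_nonneg (by positivity)).trans (le_of_eq (by ring))

section

variable {b : ℕ → ℝ}

theorem leftEnd_toNNReal_mem (h0 : b 0 = 1) (hpos : ∀ n, 0 < b n) (hb : Antitone b) (n i : ℕ) :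
    (((1 + leftOffset b n i).toNNReal : ℝ≥0) : ℝ) = 1 + leftOffset b n i ∧
      1 ≤ (1 + leftOffset b n i).toNNReal ∧ (1 + leftOffset b n i).toNNReal ≤ 2 := by
  obtain ⟨h1, h2⟩ := leftOffset_mem_Icc hb n i
  have e : (((1 + leftOffset b n i).toNNReal : ℝ≥0) : ℝ) = 1 + leftOffset b n i :=
    Real.coe_toNNReal _ (by linarith)
  refine ⟨e, ?_, ?_⟩ <;> rw [← NNReal.coe_le_coe, e]
  · simpa using h1
  · have := hpos n
    norm_num
    linarith

theorem le_measureReal_nearEvent (hB : IsPreBrownianReal B P) (h0 : b 0 = 1)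
    (hpos : ∀ n, 0 < b n) (hb : Antitone b) {n i : ℕ} (hi : i < 2 ^ n) :
    (√(4 * Real.pi))⁻¹ * Real.exp (-1) / 2 * (1 / 2 ^ n) ≤ P.real (nearEvent B b n i) := by
  obtain ⟨e, h1, h2⟩ := leftEnd_toNNReal_mem h0 hpos hb n i
  have hh : (0 : ℝ) < 1 / 2 ^ n := by positivity
  have hh1 : (1 : ℝ) / 2 ^ n ≤ 1 := by
    rw [← one_div_pow]; exact pow_le_one₀ (by norm_num) (by norm_num)
  have hi0 : (0 : ℝ) ≤ i / 2 ^ n := by positivity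
  have hi1 : (i : ℝ) / 2 ^ n ≤ 1 := by
    rw [div_le_one (by positivity)]; exact_mod_cast hi.le
  rw [nearEvent, measureReal_abs_sub_le (hB.hasLaw_eval _)]
  refine (le_of_eq ?_).trans (le_gaussianReal_Icc (by positivity) (by linarith)
    fun x hx => le_gaussianPDFReal h1 h2 (abs_le.2 ⟨by linarith [hx.1], by linarith [hx.2]⟩))
  ring

theorem measureReal_nearEvent_le (hB : IsPreBrownianReal B P) (h0 : b 0 = 1)
    (hpos : ∀ n, 0 < b n) (hb : Antitone b) (n i : ℕ) :
    P.real (nearEvent B b n i) ≤ 1 / 2 ^ n / 2 := by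
  obtain ⟨e, h1, h2⟩ := leftEnd_toNNReal_mem h0 hpos hb n i
  have hh : (0 : ℝ) < 1 / 2 ^ n := by positivity
  rw [nearEvent, measureReal_abs_sub_le (hB.hasLaw_eval _)]
  exact (gaussianReal_Icc_le (C := 1) (by positivity) (by linarith)
    fun x _ => gaussianPDFReal_le_one h1 x).trans (le_of_eq (by ring))

theorem measureReal_nearEvent_inter_le (hB : IsPreBrownianReal B P) (h0 : b 0 = 1)
    (hpos : ∀ n, 0 < b n) (hgap : ∀ n, 2 * b (n + 1) < b n) (hb : Antitone b) {n i j : ℕ}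
    (hi : i < 2 ^ n) (hj : j < 2 ^ n) :
    P.real (nearEvent B b n i ∩ nearEvent B b n j) ≤
      interaction (1 / 2 ^ n) (leftOffset b n i - leftOffset b n j) (i - j) := by
  wlog hij : i ≤ j generalizing i j
  · have := this hj hi (by omega)
    rw [inter_comm]
    refine this.trans (le_of_eq ?_)
    simp only [interaction, ← abs_sub_comm (leftOffset b n i), sub_eq_zero, mul_pow]
    rw [← neg_sub (i : ℝ) j, neg_sq]
    simp only [eq_comm]
  rcases hij.eq_or_lt with rfl | hlt
  · rw [inter_self, sub_self, sub_self, interaction, if_pos rfl]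
    exact measureReal_nearEvent_le hB h0 hpos hb n i
  · have hoff := leftOffset_add_lt hpos hgap hlt hj
    have hbn := hpos n
    have hne : (i : ℝ) - j ≠ 0 := sub_ne_zero.2 (by exact_mod_cast hlt.ne)
    have hlt' : (i : ℝ) + 1 ≤ j := by exact_mod_cast hlt
    obtain ⟨e, h1, h2⟩ := leftEnd_toNNReal_mem h0 hpos hb n i
    obtain ⟨e', h1', h2'⟩ := leftEnd_toNNReal_mem h0 hpos hb n j
    have hh : (0 : ℝ) < 1 / 2 ^ n := by positivity
    have key := measureReal_inter_le hB (t := (1 + leftOffset b n j).toNNReal)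
      (y := i / 2 ^ n) (u := (j - i) * (1 / 2 ^ n)) h1
      (NNReal.coe_lt_coe.1 (by rw [e, e']; linarith)) hh (by nlinarith)
    rw [e, e', show (i : ℝ) / 2 ^ n + (j - i) * (1 / 2 ^ n) = j / 2 ^ n by ring,
      add_sub_add_left_eq_sub] at key
    rw [interaction, if_neg hne, abs_sub_comm, abs_of_pos (by linarith), mul_pow,
      ← neg_sub (j : ℝ) i, neg_sq, ← mul_pow]
    exact key

theorem nullMeasurableSet_closeEvent (hB : IsPreBrownianReal B P) (k : ℕ) :
    NullMeasurableSet (closeEvent B b k) P :=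
  NullMeasurableSet.biUnion (countable_leftEnds b) fun t _ =>
    nullMeasurableSet_lt ((hB.aemeasurable t.toNNReal).sub_const (cantorFun b t)).abs
      aemeasurable_const

theorem hitEvent_ae_eq (hB : IsBrownianReal B P) (h0 : b 0 = 1) (hpos : ∀ n, 0 < b n)
    (hgap : ∀ n, 2 * b (n + 1) < b n) : hitEvent B b =ᵐ[P] ⋂ k, closeEvent B b k := by
  refine eventuallyEq_set.2 ?_
  filter_upwards [hB.cont] with ω hω
  refine (nonempty_zeros_inter_cantorSet_iff h0 hpos hgap hω).trans ?_
  simp [closeEvent]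

theorem exists_le_measureReal_biUnion_nearEvent [IsProbabilityMeasure P]
    (hB : IsPreBrownianReal B P) (h0 : b 0 = 1) (hpos : ∀ n, 0 < b n)
    (hgap : ∀ n, 2 * b (n + 1) < b n) (hb : Antitone b) {K : ℝ} (hK : 0 < K)
    (hsum : ∀ m : ℕ, ∑ i ∈ Finset.range (2 ^ m), ∑ j ∈ Finset.range (2 ^ m),
      interaction (1 / 2 ^ m) (leftOffset b m i - leftOffset b m j) (i - j) ≤ K) :
    ∃ c : ℝ, 0 < c ∧ ∀ n, c ≤ P.real (⋃ i ∈ Finset.range (2 ^ n), nearEvent B b n i) := by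
  set q : ℝ := (√(4 * Real.pi))⁻¹ * Real.exp (-1) / 2 with hq
  have hq0 : 0 < q := by positivity
  refine ⟨q ^ 2 / K, by positivity, fun n => ?_⟩
  have h1 : q ≤ ∑ i ∈ Finset.range (2 ^ n), P.real (nearEvent B b n i) := by
    calc q = ∑ i ∈ Finset.range (2 ^ n), q * (1 / 2 ^ n) := by
          rw [Finset.sum_const, Finset.card_range, nsmul_eq_mul]
          push_cast
          field_simp
      _ ≤ _ := Finset.sum_le_sum fun i hi =>
          le_measureReal_nearEvent hB h0 hpos hb (Finset.mem_range.1 hi)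
  have h2 : ∑ i ∈ Finset.range (2 ^ n), ∑ j ∈ Finset.range (2 ^ n),
      P.real (nearEvent B b n i ∩ nearEvent B b n j) ≤ K :=
    (Finset.sum_le_sum fun i hi => Finset.sum_le_sum fun j hj =>
      measureReal_nearEvent_inter_le hB h0 hpos hgap hb (Finset.mem_range.1 hi)
        (Finset.mem_range.1 hj)).trans (hsum n)
  -- `r = q / K` maximises `2 * r * q - r ^ 2 * K`.
  refine le_trans ?_ (le_measureReal_biUnion P _ (fun i =>
    nullMeasurableSet_abs_sub_le (hB.aemeasurable _) _ _) (q / K))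
  calc q ^ 2 / K = 2 * (q / K) * q - (q / K) ^ 2 * K := by field_simp; ring
    _ ≤ _ := sub_le_sub (mul_le_mul_of_nonneg_left h1 (by positivity))
        (mul_le_mul_of_nonneg_left h2 (by positivity))

end

end Brownian

end GenCantor

theorem mainTheorem1 {Ω : Type*} [MeasurableSpace Ω] (P : Measure Ω) [IsProbabilityMeasure P]
    (B : ℝ≥0 → Ω → ℝ) (hB : IsBrownianReal B P)
    (a : ℕ → ℝ) (ha : ∀ n, 0 < a n) (ha0 : a 0 = 1)
    (ε : ℝ) (hε : 0 < ε) (hstep : ∀ n, a n ^ 2 - 1 / 2 * a (n + 1) ^ 2 ≥ ε * a n ^ 2)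
    (hsum : Summable a ∨ Summable (fun n => 1 / a n)) :
    NullMeasurableSet (GenCantor.hitEvent B (GenCantor.lengths a)) P ∧
      0 < P (GenCantor.hitEvent B (GenCantor.lengths a)) := by
  have h0 : GenCantor.lengths a 0 = 1 := by simp [GenCantor.lengths, ha0]
  have hpos := GenCantor.lengths_pos ha
  have hgap := GenCantor.lengths_gap hstep
  have hgap' : ∀ n, 2 * GenCantor.lengths a (n + 1) < GenCantor.lengths a n := fun n => by
    linarith [hgap n, mul_pos hε (hpos n)]
  have hnull := GenCantor.nullMeasurableSet_closeEvent (b := GenCantor.lengths a)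
    hB.toIsPreBrownianReal
  have hae := GenCantor.hitEvent_ae_eq hB h0 hpos hgap'
  refine ⟨(NullMeasurableSet.iInter hnull).congr hae.symm, ?_⟩
  obtain ⟨K, hK, hKsum⟩ := GenCantor.exists_interaction_sum_le ha hε hstep hsum
  obtain ⟨c, hc, hcle⟩ := GenCantor.exists_le_measureReal_biUnion_nearEvent
    hB.toIsPreBrownianReal h0 hpos hgap' (GenCantor.antitone_of_gap hε hpos hgap) hK hKsum
  rw [measure_congr hae]
  -- Continuity from above: each `closeEvent` contains the union of near events at a fine enough
  -- level, so `c` bounds every term.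
  refine (ENNReal.ofReal_pos.2 hc).trans_le (ge_of_tendsto' (tendsto_measure_iInter_atTop hnull
    GenCantor.antitone_closeEvent ⟨0, measure_ne_top _ _⟩) fun k => ?_)
  obtain ⟨n, hn⟩ := exists_pow_lt_of_lt_one (Nat.one_div_pos_of_nat (α := ℝ) (n := k))
    (by norm_num : (1 / 2 : ℝ) < 1)
  exact (ENNReal.ofReal_le_of_le_toReal (hcle n)).trans
    (measure_mono (GenCantor.biUnion_nearEvent_subset h0 hpos hgap' hn))
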